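/- Let $d\in\{2,3\}$, let $\Omega\subset\mathbb{R}^d$ be a domain (a nonempty, connected open set), and let $\Omega_1,\dots,\Omega_{m'}\subset\Omega$ be pairwise disjoint measurable sets whose union is $\Omega$ up to a null set. Put $H:=L^2(\Omega)$ and $V:=H^1(\Omega)$, and let $b\in L^\infty(\Omega;\mathbb{R}^d)$, $f\in H$, $k\ge 1$ and $y_d^1,\dots,y_d^{k-1}\in H$ be given. For $m:=m'+2$, $u=(\kappa_1,\dots,\kappa_{m'},c,r)\in\mathbb{R}^m$ and $\varphi,\psi\in V$ let $$a(u;\varphi,\psi):=\sum_{i=1}^{m'}\kappa_i\int_{\Omega_i}\nabla\varphi\cdot\nabla\psi\,dx+c\int_\Omega (b\cdot\nabla\varphi)\,\psi\,dx+r\int_\Omega\varphi\,\psi\,dx .$$ For $\kappa_{\min}\in(0,\infty)^{m'}$, $c_{\min}<c_{\max}$ in $\mathbb{R}$ and $r_{\min}\in(0,\infty)$ let $$U_{\rm eq}:=\Big(\prod_{i=1}^{m'}(\kappa_{\min,i},\infty)\Big)\times(c_{\min},c_{\max})\times(r_{\min},\infty)\subset\mathbb{R}^m .$$ Call these constants admissible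 if for every $u\in U_{\rm eq}$ and every $g\in H$ there is exactly one $y\in V$ with $a(u;y,\varphi)=\langle g,\varphi\rangle_H$ for all $\varphi\in V$. Then admissible constants exist. Moreover, let any admissible constants be given. For $u\in U_{\rm eq}$ let $\mathcal S(u)\in V\hookrightarrow H$ be the unique solution of $a(u;\mathcal S(u),\varphi)=\langle f,\varphi\rangle_H$ for all $\varphi\in V$, and set $$J_i(u):=\tfrac12\|\mathcal S(u)-y_d^i\|_H^2\quad(1\le i\le k-1),\qquad J_k(u):=\tfrac12\|u\|_{\mathbb{R}^m}^2 .$$ Then $J_1,\dots,J_k$ are twice continuously differentiable on the open set $U_{\rm eq}$. In particular, they are twice continuously differentiable on every box $U_{\rm ad}=\{u\in\mathbb{R}^m : u_a\le u\le u_b\}$ (componentwise inequalities, $u_a,u_b\in\mathbb{R}^m$) with $U_{\rm ad}\subset U_{\rm eq}$. -/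

import Mathlib

open MeasureTheory
open scoped ContDiff

noncomputable section

namespace EllipticMOP

/-- `ℝ^d` with the Euclidean norm. -/
abbrev Space (d : ℕ) : Type := EuclideanSpace ℝ (Fin d)

/-- `H = L²(Ω)`. -/
abbrev LTwo {d : ℕ} (Ω : Set (Space d)) : Type := Lp ℝ 2 (volume.restrict Ω)

/-- `L²(Ω; ℝ^d)`. -/
abbrev LTwoVec {d : ℕ} (Ω : Set (Space d)) : Type := Lp (Space d) 2 (volume.restrict Ω)

/-- Test functions: `φ ∈ C_c^∞(Ω)`. -/
def IsTestFunction {d : ℕ} (Ω : Set (Space d)) (φ : Space d → ℝ) : Prop :=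
  ContDiff ℝ ∞ φ ∧ HasCompactSupport φ ∧ tsupport φ ⊆ Ω

/-- `G` is the weak gradient of `y` on `Ω`:
`∫_Ω y ∂_j φ = - ∫_Ω G_j φ` for all test functions `φ` and all coordinates `j`. -/
def IsWeakGradient {d : ℕ} (Ω : Set (Space d)) (y : LTwo Ω) (G : LTwoVec Ω) : Prop :=
  ∀ φ : Space d → ℝ, IsTestFunction Ω φ → ∀ j : Fin d,
    ∫ x in Ω, y x * fderiv ℝ φ x (EuclideanSpace.single j 1) = - ∫ x in Ω, G x j * φ x

theorem IsTestFunction.memLp {d : ℕ} {Ω : Set (Space d)} {φ : Space d → ℝ}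
    (h : IsTestFunction Ω φ) : MemLp φ 2 (volume.restrict Ω) :=
  (h.1.continuous.memLp_of_hasCompactSupport h.2.1).restrict Ω

theorem IsTestFunction.memLp_deriv {d : ℕ} {Ω : Set (Space d)} {φ : Space d → ℝ}
    (h : IsTestFunction Ω φ) (v : Space d) :
    MemLp (fun x => fderiv ℝ φ x v) 2 (volume.restrict Ω) := by
  have hc : Continuous fun x => fderiv ℝ φ x v :=
    (h.1.continuous_fderiv (by simp)).clm_apply continuous_const
  exact (hc.memLp_of_hasCompactSupport (h.2.1.fderiv_apply (𝕜 := ℝ) v)).restrict Ω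

theorem memLp_coord {d : ℕ} {Ω : Set (Space d)} (G : LTwoVec Ω) (j : Fin d) :
    MemLp (fun x => G x j) 2 (volume.restrict Ω) :=
  (EuclideanSpace.proj (𝕜 := ℝ) j).comp_memLp' (Lp.memLp G)

/-- The Sobolev space `V = H¹(Ω)`, realised as the space of pairs `(y, ∇y)` with `y ∈ L²(Ω)` whose
weak gradient `∇y` lies in `L²(Ω; ℝ^d)`.  It carries the inner product
`⟨y, z⟩_{L²} + ⟨∇y, ∇z⟩_{L²}`. -/
def sobolevHOne {d : ℕ} (Ω : Set (Space d)) : Submodule ℝ (WithLp 2 (LTwo Ω × LTwoVec Ω)) where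
  carrier := {p | IsWeakGradient Ω p.fst p.snd}
  zero_mem' := by
    intro φ hφ j
    have h1 : ∫ x in Ω, (0 : LTwo Ω) x * fderiv ℝ φ x (EuclideanSpace.single j 1) = 0 := by
      rw [← integral_zero (Space d) ℝ (μ := volume.restrict Ω)]
      refine integral_congr_ae ?_
      filter_upwards [Lp.coeFn_zero ℝ 2 (volume.restrict Ω)] with x hx
      rw [hx]
      simp
    have h2 : ∫ x in Ω, (0 : LTwoVec Ω) x j * φ x = 0 := by
      rw [← integral_zero (Space d) ℝ (μ := volume.restrict Ω)]
      refine integral_congr_ae ?_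
      filter_upwards [Lp.coeFn_zero (Space d) 2 (volume.restrict Ω)] with x hx
      rw [hx]
      simp
    simp only [WithLp.zero_fst, WithLp.zero_snd]
    rw [h1, h2, neg_zero]
  add_mem' := by
    intro p q hp hq φ hφ j
    have h1 : ∫ x in Ω, (p.fst + q.fst : LTwo Ω) x * fderiv ℝ φ x (EuclideanSpace.single j 1)
        = (∫ x in Ω, p.fst x * fderiv ℝ φ x (EuclideanSpace.single j 1))
          + ∫ x in Ω, q.fst x * fderiv ℝ φ x (EuclideanSpace.single j 1) := by
      refine Eq.trans ?_ (integral_add ((Lp.memLp p.fst).integrable_mul (hφ.memLp_deriv _))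
        ((Lp.memLp q.fst).integrable_mul (hφ.memLp_deriv _)))
      refine integral_congr_ae ?_
      filter_upwards [Lp.coeFn_add p.fst q.fst] with x hx
      rw [hx]
      simp [add_mul]
    have h2 : ∫ x in Ω, (p.snd + q.snd : LTwoVec Ω) x j * φ x
        = (∫ x in Ω, p.snd x j * φ x) + ∫ x in Ω, q.snd x j * φ x := by
      refine Eq.trans ?_ (integral_add ((memLp_coord p.snd j).integrable_mul hφ.memLp)
        ((memLp_coord q.snd j).integrable_mul hφ.memLp))
      refine integral_congr_ae ?_
      filter_upwards [Lp.coeFn_add p.snd q.snd] with x hx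
      rw [hx]
      simp [add_mul]
    simp only [WithLp.add_fst, WithLp.add_snd]
    rw [h1, h2, hp φ hφ j, hq φ hφ j]
    ring
  smul_mem' := by
    intro s p hp φ hφ j
    have h1 : ∫ x in Ω, (s • p.fst : LTwo Ω) x * fderiv ℝ φ x (EuclideanSpace.single j 1)
        = s * ∫ x in Ω, p.fst x * fderiv ℝ φ x (EuclideanSpace.single j 1) := by
      rw [← integral_const_mul]
      refine integral_congr_ae ?_
      filter_upwards [Lp.coeFn_smul s p.fst] with x hx
      simp [hx, mul_assoc]
    have h2 : ∫ x in Ω, (s • p.snd : LTwoVec Ω) x j * φ x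
        = s * ∫ x in Ω, p.snd x j * φ x := by
      rw [← integral_const_mul]
      refine integral_congr_ae ?_
      filter_upwards [Lp.coeFn_smul s p.snd] with x hx
      simp [hx, mul_assoc]
    simp only [WithLp.smul_fst, WithLp.smul_snd]
    rw [h1, h2, hp φ hφ j]
    ring

/-- The embedding `V = H¹(Ω) ↪ H = L²(Ω)`. -/
def toL {d : ℕ} {Ω : Set (Space d)} (v : sobolevHOne Ω) : LTwo Ω := v.1.fst

/-- The weak gradient `∇v` of `v ∈ H¹(Ω)`. -/
def grad {d : ℕ} {Ω : Set (Space d)} (v : sobolevHOne Ω) : LTwoVec Ω := v.1.snd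

/-- The parameter space `ℝ^m`, `m = m' + 2`, of parameters `u = (κ_1, …, κ_{m'}, c, r)`,
with the Euclidean norm. -/
abbrev Param (m' : ℕ) : Type := EuclideanSpace ℝ (Fin (m' + 2))

/-- The diffusion coefficient `κ_i` of `u = (κ, c, r)`. -/
def diffusion {m' : ℕ} (u : Param m') (i : Fin m') : ℝ := u (Fin.castAdd 2 i)

/-- The advection strength `c` of `u = (κ, c, r)`. -/
def advection {m' : ℕ} (u : Param m') : ℝ := u (Fin.natAdd m' 0)

/-- The reaction coefficient `r` of `u = (κ, c, r)`. -/
def reaction {m' : ℕ} (u : Param m') : ℝ := u (Fin.natAdd m' 1)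

/-- `Ω` is divided into the pairwise disjoint measurable subdomains `Ω_1, …, Ω_{m'}`
(up to a null set, such as the interfaces between open subdomains). -/
structure IsPartition {d m' : ℕ} (Ω : Set (Space d)) (Ωs : Fin m' → Set (Space d)) : Prop where
  measurable : ∀ i, MeasurableSet (Ωs i)
  subset : ∀ i, Ωs i ⊆ Ω
  disjoint : Pairwise fun i j => Disjoint (Ωs i) (Ωs j)
  cover : volume (Ω \ ⋃ i, Ωs i) = 0

/-- The bilinear form
`a(u; φ, ψ) = ∑_i κ_i ∫_{Ω_i} ∇φ · ∇ψ + c ∫_Ω (b · ∇φ) ψ + r ∫_Ω φ ψ`. -/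
def bilin {d m' : ℕ} {Ω : Set (Space d)} (Ωs : Fin m' → Set (Space d))
    (b : Lp (Space d) ⊤ (volume.restrict Ω)) (u : Param m') (φ ψ : sobolevHOne Ω) : ℝ :=
  (∑ i, diffusion u i * (∫ x in Ωs i, inner ℝ (grad φ x) (grad ψ x)))
    + advection u * (∫ x in Ω, inner ℝ (b x) (grad φ x) * toL ψ x)
    + reaction u * (∫ x in Ω, toL φ x * toL ψ x)

/-- `y ∈ V` solves the weak formulation `a(u; y, φ) = ⟨f, φ⟩_H` for all `φ ∈ V`. -/
def IsWeakSolution {d m' : ℕ} {Ω : Set (Space d)} (Ωs : Fin m' → Set (Space d))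
    (b : Lp (Space d) ⊤ (volume.restrict Ω)) (f : LTwo Ω) (u : Param m')
    (y : sobolevHOne Ω) : Prop :=
  ∀ φ : sobolevHOne Ω, bilin Ωs b u y φ = inner ℝ f (toL φ)

/-- `U_eq = (κ_min, ∞) × (c_min, c_max) × (r_min, ∞)`. -/
def paramDomain {m' : ℕ} (κmin : Fin m' → ℝ) (cmin cmax rmin : ℝ) : Set (Param m') :=
  {u | (∀ i, κmin i < diffusion u i) ∧ advection u ∈ Set.Ioo cmin cmax ∧ rmin < reaction u}

/-- `U_ad = {u | u_a ≤ u ≤ u_b}`, with componentwise inequalities. -/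
def admissible {m' : ℕ} (ua ub : Param m') : Set (Param m') :=
  {u | ∀ j, ua j ≤ u j ∧ u j ≤ ub j}

/-- Constants `κ_min ∈ (0,∞)^{m'}`, `c_min < c_max`, `r_min ∈ (0,∞)` for which the state equation
is uniquely solvable in `V` for every parameter in `U_eq` and every right-hand side in `H`. -/
structure SolvabilityConstants {d m' : ℕ} {Ω : Set (Space d)} (Ωs : Fin m' → Set (Space d))
    (b : Lp (Space d) ⊤ (volume.restrict Ω))
    (κmin : Fin m' → ℝ) (cmin cmax rmin : ℝ) : Prop where
  diffusion_pos : ∀ i, 0 < κmin i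
  advection_lt : cmin < cmax
  reaction_pos : 0 < rmin
  solvable : ∀ u ∈ paramDomain κmin cmin cmax rmin, ∀ g : LTwo Ω,
    ∃! y : sobolevHOne Ω, IsWeakSolution Ωs b g u y

open Classical in
/-- The solution operator `u ↦ 𝒮(u) ∈ V` of the state equation; it takes the (meaningless) value
`0` where there is no solution. -/
def solutionOp {d m' : ℕ} {Ω : Set (Space d)} (Ωs : Fin m' → Set (Space d))
    (b : Lp (Space d) ⊤ (volume.restrict Ω)) (f : LTwo Ω) (u : Param m') : sobolevHOne Ω :=
  if h : ∃ y : sobolevHOne Ω, IsWeakSolution Ωs b f u y then h.choose else 0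

/-- The cost functions `𝒥_1, …, 𝒥_k : H × ℝ^m → ℝ`, where `k = n + 1`:
`𝒥_i(y, u) = ½ ‖y - y_d^i‖_H²` for `i < k`, and `𝒥_k(y, u) = ½ ‖u‖²`. -/
def cost {d m' n : ℕ} {Ω : Set (Space d)} (yd : Fin n → LTwo Ω) (i : Fin (n + 1))
    (y : LTwo Ω) (u : Param m') : ℝ :=
  Fin.lastCases (motive := fun _ => ℝ) ((1 / 2 : ℝ) * ‖u‖ ^ 2)
    (fun j => (1 / 2 : ℝ) * ‖y - yd j‖ ^ 2) i

/-- The reduced cost functions `J_i(u) = 𝒥_i(𝒮(u), u)`. -/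
def reducedCost {d m' n : ℕ} {Ω : Set (Space d)} (Ωs : Fin m' → Set (Space d))
    (b : Lp (Space d) ⊤ (volume.restrict Ω)) (f : LTwo Ω) (yd : Fin n → LTwo Ω)
    (i : Fin (n + 1)) (u : Param m') : ℝ :=
  cost yd i (toL (solutionOp Ωs b f u)) u

end EllipticMOP

end

/-! The form `a(u; ·, ·)` is linear in `u`: it is a combination of fixed bounded forms, so `u` is
mapped smoothly into the operators `V → V'`. Inversion is smooth near invertible operators; hence
`𝒮(u) = A(u)⁻¹ l` is smooth wherever `A(u) : V → V'` is an isomorphism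
(`contDiffOn_of_forall_apply_eq`), and the costs are smooth functions of `u` and `𝒮(u)`.

Admissibility gives unique solvability only for data in `H`, and `A(u)` need not be coercive. The
bridge is the Gårding inequality `le_bilinCLM_self`: a multiple of the `L²` form makes `A(u)`
coercive, and the error caused by this shift is a functional from `H`, which admissibility can
correct (`bijective_of_garding`). Compactness of `V ↪ H` plays no role. Admissible constants exist
because a large `r_min` makes the shift unnecessary. -/

noncomputable section

namespace EllipticMOP

/-! ### Variational equations and smooth dependence in Hilbert spaces -/

section Abstract

/-- The real inner product as a continuous bilinear map. -/
def realInner (E : Type*) [NormedAddCommGroup E] [InnerProductSpace ℝ E] : E →L[ℝ] E →L[ℝ] ℝ :=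
  (isBoundedBilinearMap_inner (𝕜 := ℝ) (E := E)).toContinuousLinearMap

@[simp]
theorem realInner_apply {E : Type*} [NormedAddCommGroup E] [InnerProductSpace ℝ E] (x y : E) :
    realInner E x y = inner ℝ x y := rfl

variable {V H : Type*} [NormedAddCommGroup V] [InnerProductSpace ℝ V] [CompleteSpace V]
  [NormedAddCommGroup H] [InnerProductSpace ℝ H]

/-- Lax–Milgram for right-hand sides in the dual space. -/
theorem exists_unique_of_isCoercive {B : V →L[ℝ] V →L[ℝ] ℝ} (hB : IsCoercive B)
    (l : V →L[ℝ] ℝ) : ∃! v, B v = l := by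
  have key : ∀ v, B v = l ↔
      hB.continuousLinearEquivOfBilin v = (InnerProductSpace.toDual ℝ V).symm l := by
    intro v
    rw [ContinuousLinearMap.ext_iff]
    constructor
    · intro h
      refine ext_inner_right ℝ fun w => ?_
      rw [hB.continuousLinearEquivOfBilin_apply, InnerProductSpace.toDual_symm_apply, h]
    · intro h w
      rw [← hB.continuousLinearEquivOfBilin_apply, h, InnerProductSpace.toDual_symm_apply]
  simp only [key]
  exact hB.continuousLinearEquivOfBilin.bijective.existsUnique _

/-- If a bilinear form satisfies a Gårding inequality with respect to `j : V → H` and the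
variational equation is uniquely solvable for right-hand sides in `H`, then it is uniquely solvable
for right-hand sides in the dual of `V`, so that the form induces an isomorphism `V ≃ V'`. -/
theorem bijective_of_garding {A : V →L[ℝ] V →L[ℝ] ℝ} (j : V →L[ℝ] H) (s : ℝ)
    (hs : IsCoercive (A + s • (realInner H).bilinearComp j j))
    (hsolv : ∀ g : H, ∃! y, ∀ φ, A y φ = inner ℝ g (j φ)) : Function.Bijective A := by
  constructor
  · refine (injective_iff_map_eq_zero A).2 fun y hy => ?_
    exact (hsolv 0).unique (fun φ => by simp [hy]) (fun φ => by simp)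
  · intro l
    -- `w` solves the shifted equation, so `A w` misses `l` exactly by `s ⟨j w, j ·⟩`, which is a
    -- right-hand side from `H`; `z` supplies it.
    obtain ⟨w, hw, -⟩ := exists_unique_of_isCoercive hs l
    obtain ⟨z, hz, -⟩ := hsolv (s • j w)
    refine ⟨w + z, ?_⟩
    ext φ
    have h := DFunLike.congr_fun hw φ
    simp only [add_apply, smul_apply,
      ContinuousLinearMap.bilinearComp_apply, realInner_apply, smul_eq_mul] at h
    rw [map_add, add_apply, hz, ← h, real_inner_smul_left]

theorem contDiff_sum_smul_add_smul_add_smul {P E ι : Type*} [NormedAddCommGroup P]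
    [NormedSpace ℝ P] [NormedAddCommGroup E] [NormedSpace ℝ E] [Fintype ι] {κ : ι → P → ℝ}
    {c r : P → ℝ} {D : ι → E} {T R : E} {k : WithTop ℕ∞} (hκ : ∀ i, ContDiff ℝ k (κ i))
    (hc : ContDiff ℝ k c) (hr : ContDiff ℝ k r) :
    ContDiff ℝ k fun u => (∑ i, κ i u • D i) + c u • T + r u • R :=
  ((ContDiff.sum fun i _ => (hκ i).smul contDiff_const).add (hc.smul contDiff_const)).add
    (hr.smul contDiff_const)

/-- If the forms `A u = ∑ i, κ i u • D i + c u • T + r u • R` have coefficients of class `C^k` and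
induce isomorphisms `V ≃ V'` for `u ∈ s`, then the solutions of `A u (S u) = l` depend on `u ∈ s` in
a `C^k` way. -/
theorem contDiffOn_of_forall_apply_eq {P ι : Type*} [NormedAddCommGroup P] [NormedSpace ℝ P]
    [Fintype ι] {κ : ι → P → ℝ} {c r : P → ℝ} {D : ι → V →L[ℝ] V →L[ℝ] ℝ}
    {T R : V →L[ℝ] V →L[ℝ] ℝ} {l : V →L[ℝ] ℝ} {S : P → V} {s : Set P} {k : WithTop ℕ∞}
    (hκ : ∀ i, ContDiff ℝ k (κ i)) (hc : ContDiff ℝ k c) (hr : ContDiff ℝ k r)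
    (hbij : ∀ u ∈ s, Function.Bijective ((∑ i, κ i u • D i) + c u • T + r u • R))
    (hS : ∀ u ∈ s, ((∑ i, κ i u • D i) + c u • T + r u • R) (S u) = l) :
    ContDiffOn ℝ k S s := by
  set A : P → V →L[ℝ] V →L[ℝ] ℝ := fun u => (∑ i, κ i u • D i) + c u • T + r u • R
  have hA : ContDiff ℝ k A := contDiff_sum_smul_add_smul_add_smul hκ hc hr
  have hequiv : ∀ u ∈ s, ∃ e : V ≃L[ℝ] (V →L[ℝ] ℝ), (e : V →L[ℝ] V →L[ℝ] ℝ) = A u := fun u hu =>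
    ⟨.ofBijective (A u) (LinearMap.ker_eq_bot.2 (hbij u hu).1)
      (LinearMap.range_eq_top.2 (hbij u hu).2), ContinuousLinearEquiv.coe_ofBijective ..⟩
  -- `S` is arbitrary off `s`; on `s` it agrees with the total inverse, which is smooth at every
  -- isomorphism.
  refine ContDiffOn.congr (f := fun u => (A u).inverse l) (fun u hu => ?_) fun u hu => ?_
  · obtain ⟨e, he⟩ := hequiv u hu
    have h1 : ContDiffAt ℝ k ContinuousLinearMap.inverse (A u) := he ▸ contDiffAt_map_inverse e
    exact ((h1.comp u hA.contDiffAt).clm_apply contDiffAt_const).contDiffWithinAt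
  · obtain ⟨e, he⟩ := hequiv u hu
    have h1 : A u (S u) = l := hS u hu
    simp only [← he, ContinuousLinearMap.inverse_equiv] at h1 ⊢
    rw [← h1]
    exact (e.symm_apply_apply _).symm

end Abstract

/-! ### Completeness of `H¹(Ω)` -/

variable {d m' n : ℕ} {Ω : Set (Space d)}

/-- The embedding `H¹(Ω) → L²(Ω)` as a continuous linear map. -/
def toLCLM (Ω : Set (Space d)) : sobolevHOne Ω →L[ℝ] LTwo Ω :=
  (WithLp.fstL 2 ℝ (LTwo Ω) (LTwoVec Ω)).comp (sobolevHOne Ω).subtypeL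

@[simp]
theorem toLCLM_apply (v : sobolevHOne Ω) : toLCLM Ω v = toL v := rfl

/-- The weak gradient `H¹(Ω) → L²(Ω; ℝ^d)` as a continuous linear map. -/
def gradCLM (Ω : Set (Space d)) : sobolevHOne Ω →L[ℝ] LTwoVec Ω :=
  (WithLp.sndL 2 ℝ (LTwo Ω) (LTwoVec Ω)).comp (sobolevHOne Ω).subtypeL

@[simp]
theorem gradCLM_apply (v : sobolevHOne Ω) : gradCLM Ω v = grad v := rfl

theorem norm_sq_sobolevHOne (v : sobolevHOne Ω) : ‖v‖ ^ 2 = ‖toL v‖ ^ 2 + ‖grad v‖ ^ 2 :=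
  WithLp.prod_norm_sq_eq_of_L2 v.1

theorem continuous_integral_mul {X : Type*} [MeasurableSpace X] {μ : Measure X} {g : X → ℝ}
    (hg : MemLp g 2 μ) : Continuous fun y : Lp ℝ 2 μ => ∫ x, y x * g x ∂μ := by
  have h : (fun y : Lp ℝ 2 μ => ∫ x, y x * g x ∂μ) = fun y => inner ℝ (hg.toLp g) y := by
    funext y
    rw [L2.inner_def]
    refine integral_congr_ae ?_
    filter_upwards [hg.coeFn_toLp] with x hx
    simp [hx]
  rw [h]
  fun_prop

/-- Each test function and coordinate imposes an equality of two `L²`-continuous functionals.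
Completeness of `V` follows, as Lax–Milgram and the bounded inverse theorem require. -/
theorem isClosed_sobolevHOne (Ω : Set (Space d)) :
    IsClosed (sobolevHOne Ω : Set (WithLp 2 (LTwo Ω × LTwoVec Ω))) := by
  have h : (sobolevHOne Ω : Set (WithLp 2 (LTwo Ω × LTwoVec Ω))) =
      ⋂ (φ : Space d → ℝ) (_ : IsTestFunction Ω φ) (j : Fin d), {p |
        ∫ x in Ω, p.fst x * fderiv ℝ φ x (EuclideanSpace.single j 1) =
          - ∫ x in Ω, p.snd x j * φ x} := by
    ext p
    simp only [Set.mem_iInter]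
    rfl
  rw [h]
  refine isClosed_iInter fun φ => isClosed_iInter fun hφ => isClosed_iInter fun j => ?_
  have h2 : (fun p : WithLp 2 (LTwo Ω × LTwoVec Ω) => ∫ x in Ω, p.snd x j * φ x) = fun p =>
      ∫ x in Ω, (EuclideanSpace.proj (𝕜 := ℝ) j).compLpL 2 (volume.restrict Ω) p.snd x * φ x := by
    funext p
    refine integral_congr_ae ?_
    filter_upwards [(EuclideanSpace.proj (𝕜 := ℝ) j).coeFn_compLpL p.snd] with x hx
    rw [hx]
    rfl
  have hc : Continuous fun p : WithLp 2 (LTwo Ω × LTwoVec Ω) => ∫ x in Ω, p.snd x j * φ x := by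
    rw [h2]
    exact (continuous_integral_mul hφ.memLp).comp (by fun_prop)
  exact isClosed_eq ((continuous_integral_mul (hφ.memLp_deriv _)).comp (by fun_prop)) hc.neg

instance (Ω : Set (Space d)) : CompleteSpace (sobolevHOne Ω) :=
  (isClosed_sobolevHOne Ω).completeSpace_coe

/-! ### The bilinear form as a bounded operator, and its Gårding inequality -/

/-- The form `(φ, ψ) ↦ ∫_S ∇φ · ∇ψ`, for `S ⊆ Ω`. -/
def diffusionForm (Ω S : Set (Space d)) : sobolevHOne Ω →L[ℝ] sobolevHOne Ω →L[ℝ] ℝ :=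
  let R := (LpToLpRestrictCLM (Space d) (Space d) ℝ (volume.restrict Ω) 2 S).comp (gradCLM Ω)
  (realInner _).bilinearComp R R

theorem diffusionForm_apply {S : Set (Space d)} (hS : MeasurableSet S) (hSΩ : S ⊆ Ω)
    (φ ψ : sobolevHOne Ω) :
    diffusionForm Ω S φ ψ = ∫ x in S, inner ℝ (grad φ x) (grad ψ x) := by
  have hr : (volume.restrict Ω).restrict S = volume.restrict S := by
    rw [Measure.restrict_restrict hS, Set.inter_eq_self_of_subset_left hSΩ]
  rw [← hr]
  simp only [diffusionForm, ContinuousLinearMap.bilinearComp_apply, realInner_apply, L2.inner_def,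
    ContinuousLinearMap.comp_apply, gradCLM_apply]
  refine integral_congr_ae ?_
  filter_upwards [LpToLpRestrictCLM_coeFn ℝ S (grad φ), LpToLpRestrictCLM_coeFn ℝ S (grad ψ)]
    with x h1 h2
  rw [h1, h2]

/-- Pointwise multiplication `G ↦ b · G` as a map `L²(Ω; ℝ^d) → L²(Ω)`. -/
def mulField (b : Lp (Space d) ⊤ (volume.restrict Ω)) : LTwoVec Ω →L[ℝ] LTwo Ω :=
  (realInner (Space d)).holderL (volume.restrict Ω) ⊤ 2 2 b

theorem coeFn_mulField (b : Lp (Space d) ⊤ (volume.restrict Ω)) (G : LTwoVec Ω) :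
    mulField b G =ᵐ[volume.restrict Ω] fun x => inner ℝ (b x) (G x) :=
  (realInner (Space d)).coeFn_holder (r := 2) b G

/-- The form `(φ, ψ) ↦ ∫_Ω (b · ∇φ) ψ`. -/
def advectionForm (b : Lp (Space d) ⊤ (volume.restrict Ω)) :
    sobolevHOne Ω →L[ℝ] sobolevHOne Ω →L[ℝ] ℝ :=
  (realInner _).bilinearComp ((mulField b).comp (gradCLM Ω)) (toLCLM Ω)

theorem advectionForm_apply (b : Lp (Space d) ⊤ (volume.restrict Ω)) (φ ψ : sobolevHOne Ω) :
    advectionForm b φ ψ = ∫ x in Ω, inner ℝ (b x) (grad φ x) * toL ψ x := by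
  simp only [advectionForm, ContinuousLinearMap.bilinearComp_apply, realInner_apply, L2.inner_def,
    ContinuousLinearMap.comp_apply, gradCLM_apply, toLCLM_apply]
  refine integral_congr_ae ?_
  filter_upwards [coeFn_mulField b (grad φ)] with x hx
  rw [hx]
  simp [mul_comm]

/-- The form `(φ, ψ) ↦ ∫_Ω φ ψ`. -/
def reactionForm (Ω : Set (Space d)) : sobolevHOne Ω →L[ℝ] sobolevHOne Ω →L[ℝ] ℝ :=
  (realInner _).bilinearComp (toLCLM Ω) (toLCLM Ω)

theorem reactionForm_apply (φ ψ : sobolevHOne Ω) :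
    reactionForm Ω φ ψ = ∫ x in Ω, toL φ x * toL ψ x := by
  simp [reactionForm, L2.inner_def, mul_comm]

/-- The bilinear form `a(u; ·, ·)` as a continuous bilinear map on `H¹(Ω)`. -/
def bilinCLM (Ωs : Fin m' → Set (Space d)) (b : Lp (Space d) ⊤ (volume.restrict Ω))
    (u : Param m') : sobolevHOne Ω →L[ℝ] sobolevHOne Ω →L[ℝ] ℝ :=
  (∑ i, diffusion u i • diffusionForm Ω (Ωs i)) + advection u • advectionForm b
    + reaction u • reactionForm Ω

theorem bilinCLM_apply {Ωs : Fin m' → Set (Space d)} (hΩs : IsPartition Ω Ωs)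
    (b : Lp (Space d) ⊤ (volume.restrict Ω)) (u : Param m') (φ ψ : sobolevHOne Ω) :
    bilinCLM Ωs b u φ ψ = bilin Ωs b u φ ψ := by
  simp [bilinCLM, bilin, diffusionForm_apply (hΩs.measurable _) (hΩs.subset _),
    advectionForm_apply, reactionForm_apply]

/-- Disjointness and covering up to a null set enter here; they turn a lower bound on all `κ_i` into
control of the full gradient. -/
theorem sum_diffusionForm_self {Ωs : Fin m' → Set (Space d)}
    (hΩs : IsPartition Ω Ωs) (φ : sobolevHOne Ω) :
    ∑ i, diffusionForm Ω (Ωs i) φ φ = ‖grad φ‖ ^ 2 := by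
  have hae : (⋃ i, Ωs i) =ᵐ[volume] Ω :=
    (Set.iUnion_subset hΩs.subset).eventuallyLE.antisymm (ae_le_set.2 hΩs.cover)
  have hint : IntegrableOn (fun x => inner ℝ (grad φ x) (grad φ x)) Ω :=
    L2.integrable_inner (𝕜 := ℝ) (grad φ) (grad φ)
  simp only [diffusionForm_apply (hΩs.measurable _) (hΩs.subset _)]
  rw [← integral_iUnion_fintype hΩs.measurable hΩs.disjoint
    fun i => hint.mono_set (hΩs.subset i), setIntegral_congr_set hae, ← L2.inner_def (𝕜 := ℝ),
    real_inner_self_eq_norm_sq]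

theorem diffusionForm_self_nonneg (S : Set (Space d)) (φ : sobolevHOne Ω) :
    0 ≤ diffusionForm Ω S φ φ :=
  real_inner_self_nonneg (F := Lp (Space d) 2 ((volume.restrict Ω).restrict S))

/-- Gårding inequality for the form `a(u; ·, ·)`. -/
theorem le_bilinCLM_self {Ωs : Fin m' → Set (Space d)} (hΩs : IsPartition Ω Ωs) (b : Lp (Space d) ⊤ (volume.restrict Ω)) {u : Param m'} {k : ℝ}
    (hk : 0 < k) (hu : ∀ i, k ≤ diffusion u i) (φ : sobolevHOne Ω) :
    k / 2 * ‖grad φ‖ ^ 2 +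
        (reaction u - advection u ^ 2 * ‖mulField b‖ ^ 2 / (2 * k)) * ‖toL φ‖ ^ 2 ≤
      bilinCLM Ωs b u φ φ := by
  have h1 : k * ‖grad φ‖ ^ 2 ≤ ∑ i, diffusion u i * diffusionForm Ω (Ωs i) φ φ := by
    rw [← sum_diffusionForm_self hΩs, Finset.mul_sum]
    exact Finset.sum_le_sum fun i _ =>
      mul_le_mul_of_nonneg_right (hu i) (diffusionForm_self_nonneg _ _)
  have h2 : |advectionForm b φ φ| ≤ ‖mulField b‖ * ‖grad φ‖ * ‖toL φ‖ :=
    (abs_real_inner_le_norm _ _).trans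
      (mul_le_mul_of_nonneg_right ((mulField b).le_opNorm _) (norm_nonneg _))
  have h3 : reactionForm Ω φ φ = ‖toL φ‖ ^ 2 := real_inner_self_eq_norm_sq (toL φ)
  have h4 : bilinCLM Ωs b u φ φ = ∑ i, diffusion u i * diffusionForm Ω (Ωs i) φ φ +
      advection u * advectionForm b φ φ + reaction u * ‖toL φ‖ ^ 2 := by
    simp [bilinCLM, ← h3]
  have h5 : |advection u * advectionForm b φ φ| ≤
      |advection u| * (‖mulField b‖ * ‖grad φ‖ * ‖toL φ‖) := by
    rw [abs_mul]
    exact mul_le_mul_of_nonneg_left h2 (abs_nonneg _)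
  have h6 : |advection u| * (‖mulField b‖ * ‖grad φ‖ * ‖toL φ‖) ≤
      k / 2 * ‖grad φ‖ ^ 2 + advection u ^ 2 * ‖mulField b‖ ^ 2 / (2 * k) * ‖toL φ‖ ^ 2 := by
    -- Young's inequality, weighted so that the advection term consumes only half of the diffusion.
    have h7 := sq_nonneg (k * ‖grad φ‖ - |advection u| * ‖mulField b‖ * ‖toL φ‖)
    rw [← sq_abs (advection u)]
    have h8 : k / 2 * ‖grad φ‖ ^ 2 + |advection u| ^ 2 * ‖mulField b‖ ^ 2 / (2 * k) * ‖toL φ‖ ^ 2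
        - |advection u| * (‖mulField b‖ * ‖grad φ‖ * ‖toL φ‖)
        = (k * ‖grad φ‖ - |advection u| * ‖mulField b‖ * ‖toL φ‖) ^ 2 / (2 * k) := by
      field_simp
      ring
    have h9 := div_nonneg h7 (by positivity : 0 ≤ 2 * k)
    linarith
  have h10 := neg_abs_le (advection u * advectionForm b φ φ)
  rw [h4]
  linarith

theorem isCoercive_of_le {B : sobolevHOne Ω →L[ℝ] sobolevHOne Ω →L[ℝ] ℝ} {p q : ℝ} (hp : 0 < p)
    (hq : 0 < q) (h : ∀ φ, p * ‖grad φ‖ ^ 2 + q * ‖toL φ‖ ^ 2 ≤ B φ φ) : IsCoercive B := by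
  refine ⟨min p q, lt_min hp hq, fun φ => ?_⟩
  have h1 := mul_le_mul_of_nonneg_right (min_le_left p q) (sq_nonneg ‖grad φ‖)
  have h2 := mul_le_mul_of_nonneg_right (min_le_right p q) (sq_nonneg ‖toL φ‖)
  rw [mul_assoc, ← sq, norm_sq_sobolevHOne, mul_add]
  linarith [h φ]

theorem exists_pos_le_of_finite {ι : Type*} [Finite ι] {κ : ι → ℝ} (hκ : ∀ i, 0 < κ i) :
    ∃ k, 0 < k ∧ ∀ i, k ≤ κ i := by
  cases isEmpty_or_nonempty ι
  · exact ⟨1, one_pos, fun i => isEmptyElim i⟩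
  · obtain ⟨i, hi⟩ := Finite.exists_min κ
    exact ⟨κ i, hκ i, hi⟩

theorem isWeakSolution_iff {Ωs : Fin m' → Set (Space d)} (hΩs : IsPartition Ω Ωs)
    {b : Lp (Space d) ⊤ (volume.restrict Ω)} {f : LTwo Ω} {u : Param m'} {y : sobolevHOne Ω} :
    IsWeakSolution Ωs b f u y ↔ bilinCLM Ωs b u y = (realInner _ f).comp (toLCLM Ω) := by
  simp [IsWeakSolution, ContinuousLinearMap.ext_iff, bilinCLM_apply hΩs]

/-! ### Admissible constants -/

theorem exists_solvabilityConstants {Ωs : Fin m' → Set (Space d)} (hΩs : IsPartition Ω Ωs) (b : Lp (Space d) ⊤ (volume.restrict Ω)) :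
    SolvabilityConstants Ωs b (fun _ => 1) (-1) 1 (‖mulField b‖ ^ 2 + 1) where
  diffusion_pos _ := one_pos
  advection_lt := by norm_num
  reaction_pos := by positivity
  solvable u hu g := by
    obtain ⟨hκ, hc, hr⟩ := hu
    simp only [isWeakSolution_iff hΩs]
    refine exists_unique_of_isCoercive (isCoercive_of_le (half_pos one_pos) ?_
      (le_bilinCLM_self hΩs b one_pos fun i => (hκ i).le)) _
    -- With `k = 1` and `|c| ≤ 1` the Gårding loss is at most `‖mulField b‖ ^ 2 / 2`, less than `r`.
    have h1 : advection u ^ 2 ≤ 1 := (sq_le_one_iff_abs_le_one _).2 (abs_le.2 ⟨hc.1.le, hc.2.le⟩)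
    have h2 := mul_le_mul_of_nonneg_right h1 (sq_nonneg ‖mulField b‖)
    have h3 := sq_nonneg ‖mulField b‖
    linarith

/-! ### Smoothness of the solution operator and the reduced costs -/

section Solvable

variable {Ωs : Fin m' → Set (Space d)} {b : Lp (Space d) ⊤ (volume.restrict Ω)}
  {κmin : Fin m' → ℝ} {cmin cmax rmin : ℝ} {u : Param m'}

theorem SolvabilityConstants.bijective_bilinCLM (hΩs : IsPartition Ω Ωs)
    (h : SolvabilityConstants Ωs b κmin cmin cmax rmin) (hu : u ∈ paramDomain κmin cmin cmax rmin) :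
    Function.Bijective (bilinCLM Ωs b u) := by
  obtain ⟨k, hk, hkκ⟩ := exists_pos_le_of_finite h.diffusion_pos
  have hG := le_bilinCLM_self hΩs b hk fun i => (hkκ i).trans (hu.1 i).le
  refine bijective_of_garding (toLCLM Ω)
    -- The fraction cancels the Gårding loss, leaving the `L²` coefficient `r + 1`, of which `r > 0`
    -- is kept.
    (1 + advection u ^ 2 * ‖mulField b‖ ^ 2 / (2 * k))
    (isCoercive_of_le (half_pos hk) (h.reaction_pos.trans hu.2.2) fun φ => ?_) fun g => ?_
  · have h1 : inner ℝ (toL φ) (toL φ) = ‖toL φ‖ ^ 2 := real_inner_self_eq_norm_sq _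
    simp only [add_apply, smul_apply,
      ContinuousLinearMap.bilinearComp_apply, realInner_apply, toLCLM_apply, h1, smul_eq_mul]
    linarith [hG φ, sq_nonneg ‖toL φ‖]
  · simpa only [IsWeakSolution, bilinCLM_apply hΩs, toLCLM_apply] using h.solvable u hu g

theorem SolvabilityConstants.isWeakSolution_solutionOp
    (h : SolvabilityConstants Ωs b κmin cmin cmax rmin) (f : LTwo Ω)
    (hu : u ∈ paramDomain κmin cmin cmax rmin) :
    IsWeakSolution Ωs b f u (solutionOp Ωs b f u) := by
  have hex := (h.solvable u hu f).exists
  rw [solutionOp, dif_pos hex]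
  exact hex.choose_spec

theorem SolvabilityConstants.contDiffOn_solutionOp (hΩs : IsPartition Ω Ωs) (h : SolvabilityConstants Ωs b κmin cmin cmax rmin) (f : LTwo Ω)
    {k : WithTop ℕ∞} :
    ContDiffOn ℝ k (solutionOp Ωs b f) (paramDomain κmin cmin cmax rmin) := by
  refine contDiffOn_of_forall_apply_eq (κ := fun i u => diffusion u i) (c := advection)
    (r := reaction) (D := fun i => diffusionForm Ω (Ωs i)) (T := advectionForm b)
    (R := reactionForm Ω) (l := (realInner _ f).comp (toLCLM Ω)) (fun i => ?_) ?_ ?_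
    (fun u hu => h.bijective_bilinCLM hΩs hu)
    fun u hu => (isWeakSolution_iff hΩs).1 (h.isWeakSolution_solutionOp f hu)
  · unfold diffusion
    fun_prop
  · unfold advection
    fun_prop
  · unfold reaction
    fun_prop

theorem SolvabilityConstants.contDiffOn_reducedCost (hΩs : IsPartition Ω Ωs) (h : SolvabilityConstants Ωs b κmin cmin cmax rmin) (f : LTwo Ω)
    (yd : Fin n → LTwo Ω) (i : Fin (n + 1)) {k : WithTop ℕ∞} :
    ContDiffOn ℝ k (reducedCost Ωs b f yd i) (paramDomain κmin cmin cmax rmin) := by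
  unfold reducedCost cost
  induction i using Fin.lastCases with
  | last =>
    simp only [Fin.lastCases_last]
    exact (contDiff_const.mul (contDiff_id.norm_sq ℝ)).contDiffOn
  | cast j =>
    simp only [Fin.lastCases_castSucc]
    have h1 := (toLCLM Ω).contDiff.comp_contDiffOn (h.contDiffOn_solutionOp hΩs f (k := k))
    exact contDiffOn_const.mul ((h1.sub contDiffOn_const).norm_sq ℝ)

end Solvable

end EllipticMOP

end

theorem mainTheorem6 {d m' n : ℕ} (hd : d = 2 ∨ d = 3)
    (Ω : Set (EllipticMOP.Space d)) (hΩ : IsOpen Ω) (hΩc : IsConnected Ω)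
    (Ωs : Fin m' → Set (EllipticMOP.Space d)) (hΩs : EllipticMOP.IsPartition Ω Ωs)
    (b : Lp (EllipticMOP.Space d) ⊤ (volume.restrict Ω))
    (f : EllipticMOP.LTwo Ω) (yd : Fin n → EllipticMOP.LTwo Ω) :
    (∃ (κmin : Fin m' → ℝ) (cmin cmax rmin : ℝ),
        EllipticMOP.SolvabilityConstants Ωs b κmin cmin cmax rmin) ∧
    ∀ (κmin : Fin m' → ℝ) (cmin cmax rmin : ℝ),
      EllipticMOP.SolvabilityConstants Ωs b κmin cmin cmax rmin →
      ∀ i : Fin (n + 1),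
        ContDiffOn ℝ 2 (EllipticMOP.reducedCost Ωs b f yd i)
          (EllipticMOP.paramDomain κmin cmin cmax rmin) ∧
        ∀ ua ub : EllipticMOP.Param m',
          EllipticMOP.admissible ua ub ⊆ EllipticMOP.paramDomain κmin cmin cmax rmin →
          ContDiffOn ℝ 2 (EllipticMOP.reducedCost Ωs b f yd i)
            (EllipticMOP.admissible ua ub) := by
  refine ⟨⟨_, _, _, _, EllipticMOP.exists_solvabilityConstants hΩs b⟩,
    fun κmin cmin cmax rmin h i => ?_⟩
  have hJ := h.contDiffOn_reducedCost hΩs f yd i (k := 2)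
  exact ⟨hJ, fun ua ub hsub => hJ.mono hsub⟩
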